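/- \textbf{Setting.} Let $d,K,n\ge 1$ and $L\ge K$ be integers, $E=\{1,\dots,L\}$, and let $\Pi_K(E)$ be the set of lists $A=(a_1,\dots,a_K)$ of $K$ distinct items of $E$. Each item $e$ has a known feature vector $x_e\in\mathbb R^d$ with $\|x_e\|_2\le 1$ and an attraction probability $\bar w(e)\in[0,1]$, and there is $\theta^*\in\mathbb R^d$ with $\bar w(e)=x_e^\top\theta^*$ for all $e\in E$. The weights $w_1,w_2,\dots\in\{0,1\}^E$ are i.i.d., and the coordinates $w_t(e)$, $e\in E$, are independent Bernoulli variables with means $\bar w(e)$. At step $t$ the agent recommends a list $A_t=(a^t_1,\dots,a^t_K)\in\Pi_K(E)$, a function of its past observations, and then observes the click $C_t=\min\{k: w_t(a^t_k)=1\}$ ($\min\emptyset=\infty$). With $f(A,w)=1-\prod_{k=1}^K(1-w(a_k))$ and $A^*$ a maximizer of $f(\cdot,\bar w)$ over $\Pi_K(E)$, the expected $n$-step regret is $R(n)=\mathbb E\big[\sum_{t=1}^n (f(A^*,w_t)-f(A_t,w_t))\big]$. \textbf{CascadeLinUCB} with parameters $\sigma,c$ starts from $M_0=I_d$, $B_0=0$.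 At step $t$ it computes $\bar\theta_{t-1}=\sigma^{-2}M_{t-1}^{-1}B_{t-1}$ and $U_t(e)=\min\{x_e^\top\bar\theta_{t-1}+c\sqrt{x_e^\top M_{t-1}^{-1}x_e},\,1\}$ for $e\in E$; it chooses successively $a^t_k\in\arg\max_{e\in E\setminus\{a^t_1,\dots,a^t_{k-1}\}}U_t(e)$ for $k=1,\dots,K$, ties being broken in any way that depends only on the past observations; and after the click it sets $M_t=M_{t-1}+\sigma^{-2}\sum_{k\le\min\{C_t,K\}}x_{a^t_k}x_{a^t_k}^\top$ and $B_t=B_{t-1}+\sum_{k\le\min\{C_t,K\}}\mathbf 1\{C_t=k\}\,x_{a^t_k}$. \textbf{Theorem.} (1) For every $\sigma>0$ and every $$c\ \ge\ \frac1\sigma\sqrt{d\log\Big(1+\frac{nK}{d\sigma^2}\Big)+2\log(nK)}+\|\theta^*\|_2,$$ the expected $n$-step regret of CascadeLinUCB with parameters $\sigma$ and $c$ satisfies $$R(n)\ \le\ 2cK\sqrt{\frac{dn\log\big(1+\frac{nK}{d\sigma^2}\big)}{\log\big(1+\frac1{\sigma^2}\big)}}+1.$$ (2) Consequently $R(n)=\tilde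 O(Kd\sqrt n)$, independently of $L$: for every $\sigma>0$ and every $\eta\ge 0$ there is a constant $C$, depending only on $\sigma$ and $\eta$, such that for all $d,L,K,n$ and all instances as above with $\|\theta^*\|_2\le\eta$, CascadeLinUCB with parameters $\sigma$ and $c=\frac1\sigma\sqrt{d\log(1+\frac{nK}{d\sigma^2})+2\log(nK)}+\eta$ has $R(n)\le C\,Kd\sqrt n\,\log(1+nK)$. -/

import Mathlib

open MeasureTheory ProbabilityTheory

noncomputable section

namespace CascadeBandit

/-- `Π_K(E)` for `E = [L]`: lists of `K` pairwise distinct items. -/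
abbrev RecList (L K : ℕ) := Fin K ↪ Fin L

/-- The feedback: the position of the click, `⊤` (infinity) if there is none. -/
abbrev Click (K : ℕ) := WithTop (Fin K)

/-- What the agent has seen: the recommended lists and the clicks, the latest step first. -/
abbrev History (L K : ℕ) := List (RecList L K × Click K)

/-- An agent's policy: the next list is a function of the past observations. -/
abbrev Policy (L K : ℕ) := History L K → RecList L K

/-- A linear cascading bandit: `L` items with feature vectors in `ℝ^d` of Euclidean norm at most
one, attraction probabilities that are exactly linear in the features, and lists of length
`K ≤ L`. -/
structure LinearBandit (d L K : ℕ) where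
  /-- feature vectors -/
  x : Fin L → EuclideanSpace ℝ (Fin d)
  /-- the unknown parameter vector -/
  θ : EuclideanSpace ℝ (Fin d)
  /-- attraction probabilities -/
  wbar : Fin L → unitInterval
  K_le_L : K ≤ L
  linear : ∀ e, (wbar e : ℝ) = ⇑(x e) ⬝ᵥ ⇑θ
  norm_x_le : ∀ e, ‖x e‖ ≤ 1

/-- A vector of weights in `{0,1}^E`, as a real vector. -/
def toReal {L : ℕ} (w : Fin L → Bool) : Fin L → ℝ := fun e => if w e then 1 else 0

/-- The reward function `f(A, w) = 1 - ∏_k (1 - w(a_k))`. -/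
def reward {L K : ℕ} (A : RecList L K) (w : Fin L → ℝ) : ℝ := 1 - ∏ k, (1 - w (A k))

/-- The click: the first position that holds an attractive item, `⊤` if there is none. -/
def click {L K : ℕ} (A : RecList L K) (w : Fin L → Bool) : Click K :=
  (Finset.univ.filter fun k => w (A k) = true).min

/-- The positions that are observed when the click is `C`, i.e. `k ≤ min {C, K}`. -/
def observed {K : ℕ} (C : Click K) : Finset (Fin K) :=
  Finset.univ.filter fun k => (k : WithTop (Fin K)) ≤ C

/-- The Gram matrix `M_t`, after the observations in the history. -/
def gram {d L K : ℕ} (x : Fin L → EuclideanSpace ℝ (Fin d)) (σ : ℝ) :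
    History L K → Matrix (Fin d) (Fin d) ℝ
  | [] => 1
  | (A, C) :: h => gram x σ h + ∑ k ∈ observed C, (σ ^ 2)⁻¹ • Matrix.vecMulVec (x (A k)) (x (A k))

/-- The vector `B_t`, after the observations in the history. -/
def response {d L K : ℕ} (x : Fin L → EuclideanSpace ℝ (Fin d)) : History L K → (Fin d → ℝ)
  | [] => 0
  | (A, C) :: h =>
      response x h + ∑ k ∈ observed C, (if C = (k : WithTop (Fin K)) then (1 : ℝ) else 0) • ⇑(x (A k))

/-- The estimate `σ⁻² M⁻¹ B` of the parameter vector. -/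
def thetaBar {d L K : ℕ} (x : Fin L → EuclideanSpace ℝ (Fin d)) (σ : ℝ) (h : History L K) :
    Fin d → ℝ :=
  (σ ^ 2)⁻¹ • Matrix.mulVec (gram x σ h)⁻¹ (response x h)

/-- The upper confidence bound `min {x_eᵀ θ̄ + c √(x_eᵀ M⁻¹ x_e), 1}`. -/
def ucb {d L K : ℕ} (x : Fin L → EuclideanSpace ℝ (Fin d)) (σ c : ℝ) (h : History L K)
    (e : Fin L) : ℝ :=
  min (⇑(x e) ⬝ᵥ thetaBar x σ h +
    c * √(⇑(x e) ⬝ᵥ Matrix.mulVec (gram x σ h)⁻¹ (x e))) 1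

/-- `π` is CascadeLinUCB with parameters `σ` and `c`: its `k`-th item maximizes the upper
confidence bound over the items that are not among the first `k - 1`.  Ties are broken in any way
that depends on the past observations only. -/
def IsCascadeLinUCB {d L K : ℕ} (x : Fin L → EuclideanSpace ℝ (Fin d)) (σ c : ℝ)
    (π : Policy L K) : Prop :=
  ∀ (h : History L K) (k : Fin K) (e : Fin L), (∀ j < k, π h j ≠ e) →
    ucb x σ c h e ≤ ucb x σ c h (π h k)

/-- The observations in the first `t` steps when `π` meets the weights `w 0, w 1, …`. -/
def run {L K : ℕ} (π : Policy L K) (w : ℕ → Fin L → Bool) : ℕ → History L K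
  | 0 => []
  | t + 1 => (π (run π w t), click (π (run π w t)) (w t)) :: run π w t

namespace LinearBandit

variable {d L K : ℕ} (B : LinearBandit d L K)

/-- The law of the weights: independent Bernoulli variables with means `wbar e`. -/
def law : Measure (Fin L → Bool) := Measure.pi fun e => bernoulliMeasure true false (B.wbar e)

/-- `A` is an optimal list: it maximizes the expected reward `f(·, wbar)`. -/
def IsOptimal (A : RecList L K) : Prop :=
  ∀ A' : RecList L K, reward A' (fun e => (B.wbar e : ℝ)) ≤ reward A (fun e => (B.wbar e : ℝ))

/-- `w` is an i.i.d. sequence of weights drawn from the law of the bandit. -/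
def IsWeightSequence {Ω : Type*} [MeasurableSpace Ω] (μ : Measure Ω)
    (w : ℕ → Ω → Fin L → Bool) : Prop :=
  iIndepFun w μ ∧ ∀ t, HasLaw (w t) B.law μ

end LinearBandit

/-- The expected regret of `π` in `n` steps, relative to the list `Astar`. -/
def expectedRegret {L K : ℕ} {Ω : Type*} [MeasurableSpace Ω] (μ : Measure Ω)
    (w : ℕ → Ω → Fin L → Bool) (Astar : RecList L K) (π : Policy L K) (n : ℕ) : ℝ :=
  ∫ ω, ∑ t ∈ Finset.range n,
    (reward Astar (toReal (w t ω)) - reward (π (run π (fun s => w s ω) t)) (toReal (w t ω))) ∂μ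

/-- `σ⁻¹ √(d log(1 + nK/(dσ²)) + 2 log(nK))`. -/
def width (d K n : ℕ) (σ : ℝ) : ℝ :=
  σ⁻¹ * √(d * Real.log (1 + n * K / (d * σ ^ 2)) + 2 * Real.log (n * K))

end CascadeBandit

end

/-!
The proof runs the optimism argument of linear bandits for the cascade feedback.

*Confidence.* Write `M` for the Gram matrix, `S` for the accumulated noise
`σ⁻¹ ∑ (w_t(e) - wbar(e)) x_e` over the observations so far, and `‖y‖² = yᵀ M⁻¹ y` (`invQuad`).  The
potential `det M ^ (-1/2) exp (‖S‖² / 2)` is the closed form of a Gaussian mixture of exponential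
supermartingales.  Here the mixture is needed in one dimension only: by the matrix determinant lemma
and the Sherman–Morrison formula, observing one item multiplies the potential by the average of
`exp (g b - g² / 2)` over a one-dimensional normal variable `g`, where `b` is the centred weight.
Since `b` is sub-Gaussian, the expectation of that factor is at most one
(`bernoulli_mixture_le`, `potential_step_le`).  Within a list the items are revealed one at a time,
each independent of the earlier ones as they are distinct, so the potential does not increase in
expectation over a step (`LinearBandit.integral_potential_scanned_le`), nor over the run
(`LinearBandit.integral_potential_run_le`).  By Markov's inequality it exceeds `nK` with probability
at most `1 / (nK)` at each step.  Where it does not, `log det M ≤ d log (1 + nK / (dσ²))` turns the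
bound on the potential into the confidence ellipsoid
(`LinearBandit.abs_dotProduct_thetaBar_sub_le`).  A bound at each fixed step suffices, because the
regret is a sum over the steps and the failures cost at most `n · 1 / (nK) ≤ 1` in total; no maximal
inequality is used.

*Optimism.* Inside the ellipsoid the upper confidence bounds dominate the attraction probabilities,
and the greedy list maximizes the reward for them (`reward_le_of_top`).  The loss of a step is then
at most a sum over the positions of the confidence width `2c ‖x_e‖` times the probability
`∏_{j < k} (1 - wbar (a_j))` that the position is scanned (`prod_sub_prod_le`), which is the expected
sum of the widths of the observed items (`LinearBandit.reward_sub_le`).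

*Elliptical potential.* Each observed item of a step satisfies
`log (1 + σ⁻² ‖x_e‖²) ≤ log det M_t - log det M_{t-1}`, so the sum of all `‖x_e‖²` is at most
`K / log (1 + σ⁻²)` times `log det M_n`, and the Cauchy–Schwarz inequality bounds the sum of the
widths (`sum_sqrt_invQuad_le`).
-/

noncomputable section

namespace CascadeBandit

open Matrix

/-! ### Quadratic forms of inverse matrices and rank-one updates -/

section LinearAlgebra

variable {m : Type*} [Fintype m] [DecidableEq m]

/-- The quadratic form `yᵀ M⁻¹ y`, the square of the norm `‖y‖_{M⁻¹}`. -/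
def invQuad (M : Matrix m m ℝ) (y : m → ℝ) : ℝ := y ⬝ᵥ (M⁻¹ *ᵥ y)

lemma posSemidef_vecMulVec {m : Type*} [Fintype m] (v : m → ℝ) : (vecMulVec v v).PosSemidef := by
  simpa using posSemidef_vecMulVec_self_star v

lemma posDef_add_vecMulVec {m : Type*} [Fintype m] {M : Matrix m m ℝ} (hM : M.PosDef)
    (v : m → ℝ) :
    (M + vecMulVec v v).PosDef :=
  hM.add_posSemidef (posSemidef_vecMulVec v)

lemma invQuad_nonneg {M : Matrix m m ℝ} (hM : M.PosDef) (y : m → ℝ) : 0 ≤ invQuad M y := by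
  simpa [invQuad] using hM.inv.posSemidef.dotProduct_mulVec_nonneg y

lemma mulVec_inv_mulVec {M : Matrix m m ℝ} (hM : M.PosDef) (y : m → ℝ) :
    M *ᵥ (M⁻¹ *ᵥ y) = y := by
  rw [mulVec_mulVec, mul_nonsing_inv _ ((isUnit_iff_isUnit_det _).1 hM.isUnit), one_mulVec]

lemma inv_mulVec_mulVec {M : Matrix m m ℝ} (hM : M.PosDef) (y : m → ℝ) :
    M⁻¹ *ᵥ (M *ᵥ y) = y := by
  rw [mulVec_mulVec, nonsing_inv_mul _ ((isUnit_iff_isUnit_det _).1 hM.isUnit), one_mulVec]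

lemma dotProduct_inv_mulVec_comm {M : Matrix m m ℝ} (hM : M.PosDef) (x y : m → ℝ) :
    x ⬝ᵥ (M⁻¹ *ᵥ y) = y ⬝ᵥ (M⁻¹ *ᵥ x) := by
  have h : (M⁻¹)ᵀ = M⁻¹ := by simpa using hM.inv.isHermitian.eq
  rw [dotProduct_mulVec, dotProduct_comm, ← mulVec_transpose, h]

/-- The matrix determinant lemma for a symmetric rank-one update. -/
lemma det_add_vecMulVec {M : Matrix m m ℝ} (hM : M.PosDef) (v : m → ℝ) :
    (M + vecMulVec v v).det = M.det * (1 + invQuad M v) := by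
  have hdet := (isUnit_iff_isUnit_det _).1 hM.isUnit
  have := det_add_replicateCol_mul_replicateRow (ι := Unit) hdet v v
  rw [vecMulVec_eq Unit, this]
  simp [invQuad, Matrix.mul_assoc, det_unique, Matrix.mul_apply, dotProduct, mulVec,
    replicateRow, replicateCol]

/-- The Sherman–Morrison formula, for the quadratic form of the inverse. -/
lemma invQuad_add_vecMulVec {M : Matrix m m ℝ} (hM : M.PosDef) (v y : m → ℝ) :
    invQuad (M + vecMulVec v v) y =
      invQuad M y - (v ⬝ᵥ (M⁻¹ *ᵥ y)) ^ 2 / (1 + invQuad M v) := by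
  have hu : 1 + invQuad M v ≠ 0 := by have := invQuad_nonneg hM v; positivity
  set s := v ⬝ᵥ (M⁻¹ *ᵥ y) with hs
  have key : (M + vecMulVec v v) *ᵥ (M⁻¹ *ᵥ y - (s / (1 + invQuad M v)) • (M⁻¹ *ᵥ v)) = y := by
    rw [mulVec_sub, mulVec_smul, add_mulVec, add_mulVec, mulVec_inv_mulVec hM,
      mulVec_inv_mulVec hM, vecMulVec_mulVec, vecMulVec_mulVec, ← hs]
    change _ - _ • (v + MulOpposite.op (invQuad M v) • v) = y
    ext i
    simp
    field_simp
    ring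
  have hinv := inv_mulVec_mulVec (posDef_add_vecMulVec hM v)
    (M⁻¹ *ᵥ y - (s / (1 + invQuad M v)) • (M⁻¹ *ᵥ v))
  rw [key] at hinv
  unfold invQuad at hinv ⊢
  rw [hinv, dotProduct_sub, dotProduct_smul, dotProduct_inv_mulVec_comm hM y v, ← hs, smul_eq_mul]
  ring

lemma invQuad_add_smul {M : Matrix m m ℝ} (hM : M.PosDef) (y v : m → ℝ) (b : ℝ) :
    invQuad M (y + b • v) =
      invQuad M y + 2 * b * (v ⬝ᵥ (M⁻¹ *ᵥ y)) + b ^ 2 * invQuad M v := by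
  simp only [invQuad, mulVec_add, mulVec_smul, dotProduct_add, add_dotProduct, dotProduct_smul,
    smul_dotProduct, smul_eq_mul, dotProduct_inv_mulVec_comm hM y v]
  ring

lemma invQuad_smul (M : Matrix m m ℝ) (v : m → ℝ) (b : ℝ) :
    invQuad M (b • v) = b ^ 2 * invQuad M v := by
  simp only [invQuad, mulVec_smul, dotProduct_smul, smul_dotProduct, smul_eq_mul]
  ring

/-- The Cauchy–Schwarz inequality for the inner product of `M⁻¹`. -/
lemma abs_dotProduct_inv_mulVec_le {M : Matrix m m ℝ} (hM : M.PosDef) (x y : m → ℝ) :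
    |x ⬝ᵥ (M⁻¹ *ᵥ y)| ≤ √(invQuad M x) * √(invQuad M y) := by
  rw [← Real.sqrt_mul (invQuad_nonneg hM x)]
  apply Real.abs_le_sqrt
  have h : ∀ b : ℝ, 0 ≤ invQuad M x * (b * b) + (2 * (x ⬝ᵥ (M⁻¹ *ᵥ y))) * b + invQuad M y := by
    intro b
    have := invQuad_nonneg hM (y + b • x)
    rw [invQuad_add_smul hM] at this
    linarith
  have := discrim_le_zero h
  rw [discrim] at this
  linarith

lemma sqrt_invQuad_add_le {M : Matrix m m ℝ} (hM : M.PosDef) (x y : m → ℝ) :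
    √(invQuad M (x + y)) ≤ √(invQuad M x) + √(invQuad M y) := by
  have h1 := abs_dotProduct_inv_mulVec_le hM y x
  have h2 := invQuad_add_smul hM x y 1
  rw [one_smul] at h2
  apply Real.sqrt_le_iff.2 ⟨by positivity, ?_⟩
  rw [h2, add_sq, Real.sq_sqrt (invQuad_nonneg hM x), Real.sq_sqrt (invQuad_nonneg hM y)]
  have := le_abs_self (y ⬝ᵥ (M⁻¹ *ᵥ x))
  nlinarith

/-- If `M ≥ I` then `M⁻¹ ≤ I`. -/
lemma invQuad_le_dotProduct {M P : Matrix m m ℝ} (hP : P.PosSemidef) (hM : M = 1 + P)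
    (y : m → ℝ) : invQuad M y ≤ y ⬝ᵥ y := by
  have hpd : M.PosDef := hM ▸ PosDef.one.add_posSemidef hP
  set z := M⁻¹ *ᵥ y with hz
  have hMz : M *ᵥ z = y := mulVec_inv_mulVec hpd y
  have hPz : 0 ≤ z ⬝ᵥ (P *ᵥ z) := by simpa using hP.dotProduct_mulVec_nonneg z
  have h1 : z ⬝ᵥ z ≤ y ⬝ᵥ z := by
    have h3 : z ⬝ᵥ y = z ⬝ᵥ ((1 + P) *ᵥ z) := by rw [← hM, hMz]
    rw [dotProduct_comm y z, h3, add_mulVec, one_mulVec, dotProduct_add]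
    linarith
  have h2 : 0 ≤ (y - z) ⬝ᵥ (y - z) := by
    simpa using dotProduct_star_self_nonneg (y - z)
  rw [sub_dotProduct, dotProduct_sub, dotProduct_sub, dotProduct_comm z y] at h2
  change y ⬝ᵥ z ≤ _
  linarith

/-- The arithmetic–geometric mean inequality for the eigenvalues of a positive definite matrix. -/
lemma log_det_le {M : Matrix m m ℝ} (hM : M.PosDef) [Nonempty m] :
    Real.log M.det ≤ Fintype.card m * Real.log (M.trace / Fintype.card m) := by
  have hd : (0 : ℝ) < Fintype.card m := by exact_mod_cast Fintype.card_pos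
  have hpos := hM.eigenvalues_pos
  have hdet : M.det = ∏ i, hM.isHermitian.eigenvalues i := by
    simpa using hM.isHermitian.det_eq_prod_eigenvalues
  have htr : M.trace = ∑ i, hM.isHermitian.eigenvalues i := by
    simpa using hM.isHermitian.trace_eq_sum_eigenvalues
  rw [hdet, htr, Real.log_prod (fun i _ => (hpos i).ne')]
  have := strictConcaveOn_log_Ioi.concaveOn.le_map_sum (t := Finset.univ)
    (w := fun _ : m => (Fintype.card m : ℝ)⁻¹) (p := hM.isHermitian.eigenvalues)
    (fun _ _ => by positivity) (by simp [hd.ne']) (fun i _ => hpos i)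
  simp only [smul_eq_mul, ← Finset.mul_sum] at this
  rw [div_eq_inv_mul]
  calc _ = Fintype.card m * ((Fintype.card m : ℝ)⁻¹ *
        ∑ i, Real.log (hM.isHermitian.eigenvalues i)) := by field_simp
    _ ≤ _ := by gcongr

lemma posSemidef_sum_vecMulVec {m ι : Type*} [Fintype m] (s : Finset ι) (v : ι → m → ℝ) :
    (∑ i ∈ s, vecMulVec (v i) (v i)).PosSemidef :=
  posSemidef_sum s fun i _ => posSemidef_vecMulVec (v i)

lemma det_le_det_add_sum {ι : Type*} {M : Matrix m m ℝ} (hM : M.PosDef) (s : Finset ι)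
    (v : ι → m → ℝ) : M.det ≤ (M + ∑ i ∈ s, vecMulVec (v i) (v i)).det := by
  classical
  induction s using Finset.induction_on with
  | empty => simp
  | insert a s ha ih =>
    rw [Finset.sum_insert ha, add_comm (vecMulVec _ _), ← add_assoc]
    have hpd := hM.add_posSemidef (posSemidef_sum_vecMulVec s v)
    rw [det_add_vecMulVec hpd]
    have := hpd.det_pos
    have := invQuad_nonneg hpd (v a)
    nlinarith

/-- A batch of rank-one updates increases the determinant at least as much as any one of them. -/
lemma det_mul_one_add_invQuad_le {ι : Type*} {M : Matrix m m ℝ} (hM : M.PosDef) {s : Finset ι}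
    (v : ι → m → ℝ) {k : ι} (hk : k ∈ s) :
    M.det * (1 + invQuad M (v k)) ≤ (M + ∑ i ∈ s, vecMulVec (v i) (v i)).det := by
  classical
  rw [← det_add_vecMulVec hM, ← Finset.add_sum_erase _ _ hk, ← add_assoc]
  exact det_le_det_add_sum (posDef_add_vecMulVec hM _) _ v

end LinearAlgebra

/-! ### The Gaussian mixture potential and one Bernoulli observation -/

section Potential

/-- A centred Bernoulli variable is `1`-sub-Gaussian. -/
lemma bernoulli_exp_le (p : unitInterval) (g : ℝ) :
    p * Real.exp (g * (1 - p)) + (1 - p) * Real.exp (g * (0 - p)) ≤ Real.exp (g ^ 2 / 2) := by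
  have hbdd : ∀ᵐ x : ℝ ∂(bernoulliMeasure (1 : ℝ) 0 p), id x ∈ Set.Icc (0 : ℝ) 1 := by
    rw [bernoulliMeasure_def]
    simp [ae_add_measure_iff, Measure.ae_smul_measure]
  have h := (hasSubgaussianMGF_of_mem_Icc aemeasurable_id hbdd).mgf_le g
  rw [mgf, integral_bernoulliMeasure, integral_bernoulliMeasure] at h
  simp only [id_eq, smul_eq_mul, mul_one, mul_zero, add_zero] at h
  refine h.trans (Real.exp_le_exp.2 ?_)
  norm_num
  nlinarith [sq_nonneg g]

/-- Averaging `exp (g b - g² / 2)` over `g ∼ N(s, u)`. -/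
lemma integral_exp_mul_gaussianPDFReal (b s : ℝ) {u : NNReal} (hu : u ≠ 0) :
    Integrable (fun g => Real.exp (g * b - g ^ 2 / 2) * gaussianPDFReal s u g) ∧
    ∫ g, Real.exp (g * b - g ^ 2 / 2) * gaussianPDFReal s u g =
      (√(1 + u))⁻¹ * Real.exp ((-s ^ 2 + 2 * b * s + b ^ 2 * u) / (1 + u) / 2) := by
  have hu0 : (0 : ℝ) < u := by positivity
  have hv : u / (1 + u) ≠ 0 := by positivity
  have key : ∀ g, Real.exp (g * b - g ^ 2 / 2) * gaussianPDFReal s u g =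
      ((√(1 + u))⁻¹ * Real.exp ((-s ^ 2 + 2 * b * s + b ^ 2 * u) / (1 + u) / 2)) *
        gaussianPDFReal ((u * b + s) / (1 + u)) (u / (1 + u)) g := by
    intro g
    rw [gaussianPDFReal, gaussianPDFReal]
    push_cast
    have h1 : √(2 * Real.pi * (u / (1 + u))) = √(2 * Real.pi * u) / √(1 + u) := by
      rw [← Real.sqrt_div (by positivity)]; congr 1; ring
    rw [h1]
    have h2 : Real.exp (g * b - g ^ 2 / 2) * Real.exp (-(g - s) ^ 2 / (2 * u)) =
        Real.exp ((-s ^ 2 + 2 * b * s + b ^ 2 * u) / (1 + u) / 2) *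
        Real.exp (-(g - (u * b + s) / (1 + u)) ^ 2 / (2 * (u / (1 + u)))) := by
      rw [← Real.exp_add, ← Real.exp_add]
      congr 1
      field_simp
      ring
    have h3 : √(1 + (u : ℝ)) ≠ 0 := by positivity
    calc _ = (√(2 * Real.pi * u))⁻¹ *
        (Real.exp (g * b - g ^ 2 / 2) * Real.exp (-(g - s) ^ 2 / (2 * u))) := by ring
      _ = _ := by rw [h2]; field_simp
  simp_rw [key]
  refine ⟨(integrable_gaussianPDFReal _ _).const_mul _, ?_⟩
  rw [integral_const_mul, integral_gaussianPDFReal_eq_one _ hv, mul_one]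

lemma bernoulli_mixture_le (p : unitInterval) (s : ℝ) {u : ℝ} (hu : 0 ≤ u) :
    p * ((√(1 + u))⁻¹ *
        Real.exp ((-s ^ 2 + 2 * (1 - p) * s + (1 - p) ^ 2 * u) / (1 + u) / 2)) +
      (1 - p) * ((√(1 + u))⁻¹ *
        Real.exp ((-s ^ 2 + 2 * (0 - p) * s + (0 - p) ^ 2 * u) / (1 + u) / 2)) ≤ 1 := by
  rcases hu.eq_or_lt with rfl | hu
  · have h := mul_le_mul_of_nonneg_left (bernoulli_exp_le p s) (Real.exp_pos (-s ^ 2 / 2)).le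
    rw [← Real.exp_add, mul_add, mul_left_comm, mul_left_comm _ (1 - (p : ℝ)), ← Real.exp_add,
      ← Real.exp_add] at h
    refine le_trans (le_of_eq ?_) (h.trans (le_of_eq ?_))
    · simp only [add_zero, Real.sqrt_one, inv_one, one_mul, mul_zero, div_one]
      ring_nf
    · rw [← Real.exp_zero]; congr 1; ring
  · lift u to NNReal using hu.le
    have hu' : u ≠ 0 := by rintro rfl; simp at hu
    obtain ⟨i1, e1⟩ := integral_exp_mul_gaussianPDFReal (1 - p) s hu'
    obtain ⟨i0, e0⟩ := integral_exp_mul_gaussianPDFReal (0 - p) s hu'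
    rw [← e1, ← e0, ← integral_const_mul, ← integral_const_mul,
      ← integral_add (i1.const_mul _) (i0.const_mul _)]
    refine le_trans ?_ (integral_gaussianPDFReal_eq_one s hu').le
    refine integral_mono ((i1.const_mul _).add (i0.const_mul _)) (integrable_gaussianPDFReal _ _)
      fun g => ?_
    have h := mul_le_mul_of_nonneg_left (bernoulli_exp_le p g) (Real.exp_pos (-g ^ 2 / 2)).le
    rw [← Real.exp_add, mul_add, mul_left_comm, mul_left_comm _ (1 - (p : ℝ)), ← Real.exp_add,
      ← Real.exp_add, show -g ^ 2 / 2 + g ^ 2 / 2 = 0 by ring, Real.exp_zero] at h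
    have := mul_le_mul_of_nonneg_right h (gaussianPDFReal_nonneg s u g)
    refine le_trans (le_of_eq ?_) (this.trans (le_of_eq (one_mul _)))
    ring_nf

variable {m : Type*} [Fintype m] [DecidableEq m]

/-- The Gaussian mixture of the exponential supermartingales `exp (λᵀ S - λᵀ (M - 1) λ / 2)` over
`λ ∼ N(0, I)`, in closed form: `det M ^ (-1/2) exp (‖S‖² / 2)` with the norm `‖·‖_{M⁻¹}`. -/
def potential (M : Matrix m m ℝ) (S : m → ℝ) : ℝ := (√M.det)⁻¹ * Real.exp (invQuad M S / 2)

lemma potential_nonneg (M : Matrix m m ℝ) (S : m → ℝ) : 0 ≤ potential M S := by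
  unfold potential; positivity

lemma potential_add_vecMulVec {M : Matrix m m ℝ} (hM : M.PosDef) (S v : m → ℝ) (b : ℝ) :
    potential (M + vecMulVec v v) (S + b • v) = potential M S * ((√(1 + invQuad M v))⁻¹ *
      Real.exp ((-(v ⬝ᵥ (M⁻¹ *ᵥ S)) ^ 2 + 2 * b * (v ⬝ᵥ (M⁻¹ *ᵥ S)) + b ^ 2 * invQuad M v) /
        (1 + invQuad M v) / 2)) := by
  have hu := invQuad_nonneg hM v
  have e : invQuad (M + vecMulVec v v) (S + b • v) / 2 = invQuad M S / 2 +
      (-(v ⬝ᵥ (M⁻¹ *ᵥ S)) ^ 2 + 2 * b * (v ⬝ᵥ (M⁻¹ *ᵥ S)) + b ^ 2 * invQuad M v) /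
        (1 + invQuad M v) / 2 := by
    rw [invQuad_add_vecMulVec hM, invQuad_add_smul hM, mulVec_add, mulVec_smul, dotProduct_add,
      dotProduct_smul, smul_eq_mul]
    have : v ⬝ᵥ (M⁻¹ *ᵥ v) = invQuad M v := rfl
    rw [this]
    field_simp
    ring
  rw [potential, e, det_add_vecMulVec hM, Real.sqrt_mul hM.det_pos.le, Real.exp_add, potential,
    mul_inv]
  ring

/-- Observing one Bernoulli variable with mean `p` does not increase the expected potential. -/
lemma potential_step_le {M : Matrix m m ℝ} (hM : M.PosDef) (S v : m → ℝ) (p : unitInterval) :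
    p * potential (M + vecMulVec v v) (S + (1 - p : ℝ) • v) +
      (1 - p) * potential (M + vecMulVec v v) (S + (0 - p : ℝ) • v) ≤ potential M S := by
  rw [potential_add_vecMulVec hM, potential_add_vecMulVec hM]
  have h := mul_le_mul_of_nonneg_left
    (bernoulli_mixture_le p (v ⬝ᵥ (M⁻¹ *ᵥ S)) (invQuad_nonneg hM v)) (potential_nonneg M S)
  rw [mul_one] at h
  refine le_trans (le_of_eq ?_) h
  ring

end Potential

/-! ### Scanned positions of a list -/

section Scan

variable {d L K : ℕ}

/-- The positions before `m` that the user scans: those with no attractive item ahead of them. -/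
def scanned (A : RecList L K) (w : Fin L → Bool) (m : ℕ) : Finset (Fin K) :=
  Finset.univ.filter fun k => (k : ℕ) < m ∧ ∀ j < k, w (A j) = false

lemma mem_scanned {A : RecList L K} {w : Fin L → Bool} {m : ℕ} {k : Fin K} :
    k ∈ scanned A w m ↔ (k : ℕ) < m ∧ ∀ j < k, w (A j) = false := by
  simp [scanned]

lemma le_click_iff {A : RecList L K} {w : Fin L → Bool} {k : Fin K} :
    (k : WithTop (Fin K)) ≤ click A w ↔ ∀ j < k, w (A j) = false := by
  simp only [click, Finset.le_min_iff, Finset.mem_filter, Finset.mem_univ, true_and,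
    WithTop.coe_le_coe]
  refine forall_congr' fun j => ?_
  rw [← not_lt]
  cases w (A j) <;> simp

lemma observed_click (A : RecList L K) (w : Fin L → Bool) :
    observed (click A w) = scanned A w K := by
  ext k
  simp [observed, mem_scanned, le_click_iff]

/-- On a scanned position, the click reveals the weight of the item. -/
lemma ite_click_eq {A : RecList L K} {w : Fin L → Bool} {k : Fin K}
    (hk : k ∈ observed (click A w)) :
    (if click A w = (k : WithTop (Fin K)) then (1 : ℝ) else 0) = toReal w (A k) := by
  rw [observed_click, mem_scanned] at hk
  have : click A w = (k : WithTop (Fin K)) ↔ w (A k) = true := by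
    constructor
    · intro h
      have := Finset.mem_of_min h
      simpa using this
    · intro h
      refine le_antisymm (Finset.min_le (by simpa using h)) (le_click_iff.2 hk.2)
  simp [toReal, this]

lemma scanned_succ (A : RecList L K) (w : Fin L → Bool) (k : Fin K) :
    scanned A w (k + 1) =
      if ∀ j < k, w (A j) = false then insert k (scanned A w k) else scanned A w k := by
  ext i
  split_ifs with h
  · rw [Finset.mem_insert, mem_scanned, mem_scanned, Nat.lt_succ_iff_lt_or_eq, or_and_right,
      or_comm]
    refine or_congr_left ⟨fun hi => Fin.ext hi.1, ?_⟩
    rintro rfl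
    exact ⟨rfl, h⟩
  · rw [mem_scanned, mem_scanned]
    refine and_congr_left fun hi => ?_
    rw [Nat.lt_succ_iff_lt_or_eq, or_iff_left]
    intro e
    rw [Fin.ext e] at hi
    exact h hi

lemma notMem_scanned (A : RecList L K) (w : Fin L → Bool) (k : Fin K) : k ∉ scanned A w k := by
  simp [mem_scanned]

lemma update_eq_of_lt (A : RecList L K) (w : Fin L → Bool) {j k : Fin K} (h : j < k) (b : Bool) :
    Function.update w (A k) b (A j) = w (A j) :=
  Function.update_of_ne (fun e => h.ne (A.injective e)) _ _

lemma scanned_update (A : RecList L K) (w : Fin L → Bool) (k : Fin K) (b : Bool) :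
    scanned A (Function.update w (A k) b) k = scanned A w k := by
  ext i
  rw [mem_scanned, mem_scanned]
  refine and_congr_right fun hi => forall₂_congr fun j hj => ?_
  rw [update_eq_of_lt A w (hj.trans hi)]

end Scan

/-! ### Expectations under the law of the weights -/

namespace LinearBandit

variable {d L K : ℕ} (B : LinearBandit d L K)

instance : IsProbabilityMeasure B.law := by unfold law; infer_instance

lemma integral_law_mono_of_update {F G : (Fin L → Bool) → ℝ} (hF : ∀ w, 0 ≤ F w)
    (hG : ∀ w, 0 ≤ G w) (e : Fin L)
    (h : ∀ w, B.wbar e * F (Function.update w e true) +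
        (1 - B.wbar e) * F (Function.update w e false) ≤ G w)
    (hGe : ∀ w b, G (Function.update w e b) = G w) :
    ∫ w, F w ∂B.law ≤ ∫ w, G w ∂B.law := by
  have h1 : ∫⁻ w, ENNReal.ofReal (F w) ∂B.law ≤ ∫⁻ w, ENNReal.ofReal (G w) ∂B.law := by
    refine lintegral_le_of_lmarginal_le {e} (measurable_of_finite _) (measurable_of_finite _) ?_
    rw [lmarginal_singleton, lmarginal_singleton]
    intro w
    simp only [hGe, lintegral_const, measure_univ, mul_one]
    rw [← ofReal_integral_eq_lintegral_ofReal (Integrable.of_finite)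
      (Filter.Eventually.of_forall fun _ => hF _), integral_bernoulliMeasure]
    exact ENNReal.ofReal_le_ofReal (h w)
  rwa [← ofReal_integral_eq_lintegral_ofReal Integrable.of_finite
      (Filter.Eventually.of_forall hF), ← ofReal_integral_eq_lintegral_ofReal Integrable.of_finite
      (Filter.Eventually.of_forall hG), ENNReal.ofReal_le_ofReal_iff (integral_nonneg hG)] at h1

/-- The scanned items of a list are revealed one at a time, and each of them leaves the expected
potential no larger. -/
lemma integral_potential_scanned_le {M : Matrix (Fin d) (Fin d) ℝ} (hM : M.PosDef)
    (S : Fin d → ℝ) (A : RecList L K) (v : Fin K → Fin d → ℝ) {m : ℕ} (hm : m ≤ K) :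
    ∫ w, potential (M + ∑ k ∈ scanned A w m, vecMulVec (v k) (v k))
      (S + ∑ k ∈ scanned A w m, (toReal w (A k) - B.wbar (A k)) • v k) ∂B.law ≤
      potential M S := by
  induction m with
  | zero => simp [scanned]
  | succ m ih =>
    refine le_trans ?_ (ih (by omega))
    obtain ⟨k, rfl⟩ : ∃ k : Fin K, (k : ℕ) = m := ⟨⟨m, hm⟩, rfl⟩
    have hsum : ∀ w b, ∑ i ∈ scanned A w k,
        (toReal (Function.update w (A k) b) (A i) - B.wbar (A i) : ℝ) • v i =
        ∑ i ∈ scanned A w k, (toReal w (A i) - B.wbar (A i) : ℝ) • v i := fun w b =>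
      Finset.sum_congr rfl fun i hi => by
        rw [toReal, toReal, update_eq_of_lt A w (mem_scanned.1 hi).1]
    refine B.integral_law_mono_of_update (fun _ => potential_nonneg _ _)
      (fun _ => potential_nonneg _ _) (A k) (fun w => ?_) (fun w b => ?_)
    · have hiff : ∀ b, (∀ j < k, Function.update w (A k) b (A j) = false) ↔
          ∀ j < k, w (A j) = false := fun b => forall₂_congr fun j hj => by
        rw [update_eq_of_lt A w hj]
      simp only [scanned_succ, hiff, scanned_update]
      split_ifs with h
      · simp only [Finset.sum_insert (notMem_scanned A w k), hsum]
        have := potential_step_le (hM.add_posSemidef (posSemidef_sum_vecMulVec (scanned A w k) v))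
          (S + ∑ i ∈ scanned A w k, (toReal w (A i) - B.wbar (A i) : ℝ) • v i) (v k)
          (B.wbar (A k))
        simp only [toReal, Function.update_self, if_true, Bool.false_eq_true, if_false] at this ⊢
        refine le_trans (le_of_eq ?_) this
        simp only [add_assoc, add_comm (vecMulVec (v k) (v k)),
          add_comm ((_ : ℝ) • v k)]
      · simp only [hsum]
        apply le_of_eq; ring
    · simp only [scanned_update, hsum]

lemma integral_prod_one_sub (A : RecList L K) (s : Finset (Fin K)) :
    ∫ w, ∏ k ∈ s, (1 - toReal w (A k)) ∂B.law = ∏ k ∈ s, (1 - (B.wbar (A k) : ℝ)) := by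
  classical
  have h1 : ∀ g : Fin L → ℝ, ∏ k ∈ s, g (A k) = ∏ e, if e ∈ s.map A then g e else 1 := by
    intro g
    rw [Finset.prod_ite_mem, Finset.univ_inter, Finset.prod_map]
  have h2 : ∀ w : Fin L → Bool, ∏ k ∈ s, (1 - toReal w (A k)) =
      ∏ e, (fun (e : Fin L) (b : Bool) =>
        if e ∈ s.map A then 1 - (if b then (1 : ℝ) else 0) else 1) e (w e) :=
    fun w => h1 fun e => 1 - toReal w e
  simp_rw [h2]
  have h3 := integral_fintype_prod_eq_prod (𝕜 := ℝ)
    (μ := fun e => bernoulliMeasure true false (B.wbar e))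
    (fun (e : Fin L) (b : Bool) => if e ∈ s.map A then 1 - (if b then (1 : ℝ) else 0) else 1)
  rw [law, h3, h1 fun e => 1 - (B.wbar e : ℝ)]
  refine Finset.prod_congr rfl fun e _ => ?_
  rw [integral_bernoulliMeasure]
  by_cases he : e ∈ s.map A <;> simp only [he, if_true, if_false] <;> simp

lemma integral_reward (A : RecList L K) :
    ∫ w, reward A (toReal w) ∂B.law = reward A fun e => (B.wbar e : ℝ) := by
  unfold reward
  rw [integral_sub Integrable.of_finite Integrable.of_finite, B.integral_prod_one_sub]
  simp

/-- Position `k` is scanned exactly if the items ahead of it are all unattractive, which has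
probability `∏_{j < k} (1 - wbar (A j))`. -/
lemma integral_sum_observed (A : RecList L K) (g : Fin K → ℝ) :
    ∫ w, ∑ k ∈ observed (click A w), g k ∂B.law =
      ∑ k, (∏ j ∈ Finset.Iio k, (1 - (B.wbar (A j) : ℝ))) * g k := by
  have h : ∀ w, ∑ k ∈ observed (click A w), g k =
      ∑ k, (∏ j ∈ Finset.Iio k, (1 - toReal w (A j))) * g k := by
    intro w
    rw [observed_click, scanned, Finset.sum_filter]
    refine Finset.sum_congr rfl fun k _ => ?_
    split_ifs with hk
    · rw [Finset.prod_eq_one fun j hj => by simp [toReal, hk.2 j (Finset.mem_Iio.1 hj)], one_mul]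
    · simp only [Fin.is_lt, true_and, not_forall] at hk
      obtain ⟨j, hj, hw⟩ := hk
      rw [Finset.prod_eq_zero (Finset.mem_Iio.2 hj) (by simp [toReal, hw]), zero_mul]
  simp_rw [h]
  rw [integral_finsetSum _ fun _ _ => Integrable.of_finite]
  refine Finset.sum_congr rfl fun k _ => ?_
  rw [integral_mul_const, B.integral_prod_one_sub]

end LinearBandit

/-! ### Independence of the history and the current weights -/

section Run

variable {d L K : ℕ}

lemma run_congr (π : Policy L K) {w w' : ℕ → Fin L → Bool} {t : ℕ} (h : ∀ s < t, w s = w' s) :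
    run π w t = run π w' t := by
  induction t with
  | zero => rfl
  | succ t ih => rw [run, run, ih fun s hs => h s (by omega), h t (by omega)]

lemma length_run (π : Policy L K) (w : ℕ → Fin L → Bool) (t : ℕ) : (run π w t).length = t := by
  induction t with
  | zero => rfl
  | succ t ih => rw [run, List.length_cons, ih]

/-- The history after `t` steps, as a function of the first `t` weight vectors. -/
def prefixRun (π : Policy L K) (t : ℕ) (p : Finset.range t → Fin L → Bool) : History L K :=
  run π (fun s => if h : s ∈ Finset.range t then p ⟨s, h⟩ else fun _ => false) t

lemma prefixRun_eq (π : Policy L K) (w : ℕ → Fin L → Bool) (t : ℕ) :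
    prefixRun π t (fun s => w s) = run π w t :=
  run_congr π fun s hs => by simp [hs]

variable {B : LinearBandit d L K} {Ω : Type*} [MeasurableSpace Ω] {μ : Measure Ω}
  [IsProbabilityMeasure μ] {w : ℕ → Ω → Fin L → Bool}

lemma integrable_run_weight (hw : B.IsWeightSequence μ w) (π : Policy L K) (t : ℕ)
    (F : History L K → (Fin L → Bool) → ℝ) :
    Integrable (fun ω => F (run π (fun s => w s ω) t) (w t ω)) μ := by
  have hm : AEMeasurable
      (fun ω => ((fun s : Finset.range t => w s ω), w t ω)) μ :=
    (aemeasurable_pi_lambda (fun ω => fun s : Finset.range t => w s ω)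
      fun s => (hw.2 s).aemeasurable).prodMk (hw.2 t).aemeasurable
  have hi : Integrable (fun q : (Finset.range t → Fin L → Bool) × (Fin L → Bool) =>
      F (prefixRun π t q.1) q.2)
      (μ.map (fun ω => ((fun s : Finset.range t => w s ω), w t ω))) := by
    have := Measure.isProbabilityMeasure_map hm
    exact Integrable.of_finite
  have := hi.comp_aemeasurable hm
  have hr : ∀ ω, prefixRun π t (fun s => w s ω) = run π (fun s => w s ω) t :=
    fun ω => prefixRun_eq π (fun s => w s ω) t
  simpa only [Function.comp_def, hr] using this

lemma integrable_run (hw : B.IsWeightSequence μ w) (π : Policy L K) (t : ℕ)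
    (F : History L K → ℝ) : Integrable (fun ω => F (run π (fun s => w s ω) t)) μ :=
  integrable_run_weight hw π t fun h _ => F h

/-- The weights of a step are independent of the past: conditionally on the history, they have
the law of the bandit. -/
lemma integral_run_weight (hw : B.IsWeightSequence μ w) (π : Policy L K) (t : ℕ)
    (F : History L K → (Fin L → Bool) → ℝ) :
    ∫ ω, F (run π (fun s => w s ω) t) (w t ω) ∂μ =
      ∫ ω, ∫ v, F (run π (fun s => w s ω) t) v ∂B.law ∂μ := by
  have hp : AEMeasurable (fun ω => (fun s : Finset.range t => w s ω)) μ :=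
    aemeasurable_pi_lambda _ fun s => (hw.2 s).aemeasurable
  have ht := (hw.2 t).aemeasurable
  have hm := hp.prodMk ht
  have hind : IndepFun (fun ω => (fun s : Finset.range t => w s ω)) (w t) μ := by
    have h0 := hw.1.indepFun_finset₀ (Finset.range t) {t} (by simp)
      fun i => (hw.2 i).aemeasurable
    exact h0.comp (φ := id) (ψ := fun f : ({t} : Finset ℕ) → Fin L → Bool =>
      f ⟨t, Finset.mem_singleton_self t⟩) measurable_id (measurable_pi_apply _)
  have hmap := (indepFun_iff_map_prod_eq_prod_map_map hp ht).1 hind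
  rw [(hw.2 t).map_eq] at hmap
  have := Measure.isProbabilityMeasure_map (μ := μ) hp
  have hr : ∀ ω, prefixRun π t (fun s => w s ω) = run π (fun s => w s ω) t :=
    fun ω => prefixRun_eq π (fun s => w s ω) t
  have e1 : ∫ ω, F (run π (fun s => w s ω) t) (w t ω) ∂μ =
      ∫ q, F (prefixRun π t q.1) q.2
        ∂(μ.map (fun ω => ((fun s : Finset.range t => w s ω), w t ω))) := by
    rw [integral_map hm (measurable_of_finite _).aestronglyMeasurable]
    simp only [hr]
  rw [e1, hmap, integral_prod _ Integrable.of_finite,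
    integral_map hp (measurable_of_finite _).aestronglyMeasurable]
  simp only [hr]

end Run

/-! ### The Gram matrix along a run -/

section Gram

variable {d L K : ℕ} (x : Fin L → EuclideanSpace ℝ (Fin d)) (σ : ℝ)

lemma dotProduct_self_eq_norm_sq (v : EuclideanSpace ℝ (Fin d)) : ⇑v ⬝ᵥ ⇑v = ‖v‖ ^ 2 := by
  rw [EuclideanSpace.real_norm_sq_eq]
  simp [dotProduct, sq]

lemma gram_cons (A : RecList L K) (C : Click K) (h : History L K) :
    gram x σ ((A, C) :: h) = gram x σ h +
      ∑ k ∈ observed C, vecMulVec (σ⁻¹ • ⇑(x (A k))) (σ⁻¹ • ⇑(x (A k))) := by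
  rw [gram]
  congr 1
  refine Finset.sum_congr rfl fun k _ => ?_
  ext i j
  simp [vecMulVec_apply]
  ring

lemma exists_gram_eq_one_add (h : History L K) :
    ∃ P : Matrix (Fin d) (Fin d) ℝ, P.PosSemidef ∧ gram x σ h = 1 + P := by
  induction h with
  | nil => exact ⟨0, PosSemidef.zero, by simp [gram]⟩
  | cons a h ih =>
    obtain ⟨P, hP, e⟩ := ih
    exact ⟨_, hP.add (posSemidef_sum_vecMulVec _ _), by rw [gram_cons, e, add_assoc]⟩

lemma posDef_gram (h : History L K) : (gram x σ h).PosDef := by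
  obtain ⟨P, hP, e⟩ := exists_gram_eq_one_add x σ h
  exact e ▸ PosDef.one.add_posSemidef hP

lemma invQuad_gram_le (h : History L K) (y : Fin d → ℝ) : invQuad (gram x σ h) y ≤ y ⬝ᵥ y := by
  obtain ⟨P, hP, e⟩ := exists_gram_eq_one_add x σ h
  exact invQuad_le_dotProduct hP e y

variable {x}

lemma invQuad_gram_le_one (hx : ∀ e, ‖x e‖ ≤ 1) (h : History L K) (e : Fin L) :
    invQuad (gram x σ h) (x e) ≤ 1 :=
  (invQuad_gram_le x σ h _).trans <| by
    rw [dotProduct_self_eq_norm_sq]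
    exact pow_le_one₀ (norm_nonneg _) (hx e)

lemma card_observed_le (C : Click K) : (observed C).card ≤ K := by
  simpa using Finset.card_le_univ (observed C)

lemma trace_gram_le (hx : ∀ e, ‖x e‖ ≤ 1) (h : History L K) :
    (gram x σ h).trace ≤ d + h.length * K / σ ^ 2 := by
  induction h with
  | nil => simp [gram, trace_one]
  | cons a h ih =>
    rw [gram_cons, trace_add, trace_sum]
    have h1 : ∀ k ∈ observed a.2, (vecMulVec (σ⁻¹ • ⇑(x (a.1 k))) (σ⁻¹ • ⇑(x (a.1 k)))).trace ≤
        1 / σ ^ 2 := by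
      intro k _
      rw [trace_vecMulVec, dotProduct_smul, smul_dotProduct, dotProduct_self_eq_norm_sq,
        smul_eq_mul, smul_eq_mul]
      have := pow_le_one₀ (n := 2) (norm_nonneg _) (hx (a.1 k))
      calc _ = ‖x (a.1 k)‖ ^ 2 / σ ^ 2 := by ring
        _ ≤ _ := by gcongr
    have h2 := Finset.sum_le_card_nsmul _ _ _ h1
    have h3 : ((observed a.2).card : ℝ) ≤ K := by exact_mod_cast card_observed_le a.2
    have h4 : ((observed a.2).card : ℝ) * (1 / σ ^ 2) ≤ K * (1 / σ ^ 2) := by gcongr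
    rw [nsmul_eq_mul] at h2
    rw [List.length_cons]
    push_cast
    have e : (d : ℝ) + (h.length + 1) * K / σ ^ 2 =
      d + h.length * K / σ ^ 2 + K * (1 / σ ^ 2) := by ring
    rw [e]
    linarith

lemma log_det_gram_le (hd : 0 < d) (hx : ∀ e, ‖x e‖ ≤ 1) {n : ℕ} {h : History L K}
    (hn : h.length ≤ n) :
    Real.log (gram x σ h).det ≤ d * Real.log (1 + n * K / (d * σ ^ 2)) := by
  have : Nonempty (Fin d) := ⟨⟨0, hd⟩⟩
  have hd' : (0 : ℝ) < d := by exact_mod_cast hd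
  have h1 := log_det_le (posDef_gram x σ h)
  rw [Fintype.card_fin] at h1
  refine h1.trans ?_
  have htr := (posDef_gram x σ h).trace_pos
  have hn' : (h.length : ℝ) ≤ n := by exact_mod_cast hn
  gcongr
  calc (gram x σ h).trace / d ≤ (d + h.length * K / σ ^ 2) / d := by
        gcongr; exact trace_gram_le σ hx h
    _ ≤ (d + n * K / σ ^ 2) / d := by gcongr
    _ = _ := by
      rw [add_div, div_self hd'.ne', div_div, mul_comm (σ ^ 2)]

/-- The norms `‖x_e‖_{M⁻¹}` of a batch of observed items are controlled by the growth of
`log det M`; the factor `K` is due to the matrix `M` not being updated within the batch. -/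
lemma sum_invQuad_le (hσ : 0 < σ) (hx : ∀ e, ‖x e‖ ≤ 1) (h : History L K) (A : RecList L K)
    (C : Click K) :
    ∑ k ∈ observed C, invQuad (gram x σ h) (x (A k)) ≤
      K / Real.log (1 + 1 / σ ^ 2) *
        (Real.log (gram x σ ((A, C) :: h)).det - Real.log (gram x σ h).det) := by
  have hpd := posDef_gram x σ h
  have hl : 0 < Real.log (1 + 1 / σ ^ 2) := Real.log_pos (by simp; positivity)
  set D := Real.log (gram x σ ((A, C) :: h)).det - Real.log (gram x σ h).det with hD
  have hterm : ∀ k ∈ observed C,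
      invQuad (gram x σ h) (x (A k)) ≤ D / Real.log (1 + 1 / σ ^ 2) := by
    intro k hk
    set q := invQuad (gram x σ h) (x (A k)) with hq
    have hq0 : 0 ≤ q := invQuad_nonneg hpd _
    have hq1 : q ≤ 1 := invQuad_gram_le_one σ hx h _
    rw [le_div_iff₀ hl]
    have h1 := det_mul_one_add_invQuad_le hpd (s := observed C)
      (fun k => σ⁻¹ • ⇑(x (A k))) hk
    rw [← gram_cons, invQuad_smul, ← hq] at h1
    have hpos : 0 < 1 + σ⁻¹ ^ 2 * q := by positivity
    have h2 := Real.log_le_log (mul_pos hpd.det_pos hpos) h1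
    rw [Real.log_mul hpd.det_pos.ne' hpos.ne'] at h2
    -- concavity of the logarithm on the segment from `1` to `1 + σ⁻²`
    have h3 := strictConcaveOn_log_Ioi.concaveOn.2 (Set.mem_Ioi.2 one_pos)
      (Set.mem_Ioi.2 (by positivity : 0 < 1 + 1 / σ ^ 2)) (by linarith : 0 ≤ 1 - q) hq0 (by ring)
    simp only [smul_eq_mul, Real.log_one, mul_zero, zero_add] at h3
    rw [show (1 - q) * 1 + q * (1 + 1 / σ ^ 2) = 1 + σ⁻¹ ^ 2 * q by
      rw [inv_pow]; ring] at h3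
    linarith
  have hD0 : 0 ≤ D := by
    rw [hD, sub_nonneg, gram_cons]
    exact Real.log_le_log hpd.det_pos (det_le_det_add_sum hpd _ _)
  have h3 : ((observed C).card : ℝ) ≤ K := by exact_mod_cast card_observed_le C
  calc _ ≤ (observed C).card • (D / Real.log (1 + 1 / σ ^ 2)) :=
        Finset.sum_le_card_nsmul _ _ _ hterm
    _ ≤ K * (D / Real.log (1 + 1 / σ ^ 2)) := by
        rw [nsmul_eq_mul]; gcongr
    _ = _ := by ring

/-- The elliptical potential lemma, along a run of any policy. -/
lemma sum_sqrt_invQuad_le (hd : 0 < d) (hσ : 0 < σ) (hx : ∀ e, ‖x e‖ ≤ 1) (π : Policy L K)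
    (w : ℕ → Fin L → Bool) (n : ℕ) :
    ∑ t ∈ Finset.range n, ∑ k ∈ observed (click (π (run π w t)) (w t)),
        √(invQuad (gram x σ (run π w t)) (x (π (run π w t) k))) ≤
      K * √(d * n * Real.log (1 + n * K / (d * σ ^ 2)) / Real.log (1 + 1 / σ ^ 2)) := by
  have hl : 0 < Real.log (1 + 1 / σ ^ 2) := Real.log_pos (by simp; positivity)
  set O : ℕ → Finset (Fin K) := fun t => observed (click (π (run π w t)) (w t)) with hO
  set q : ℕ → Fin K → ℝ := fun t k =>
    invQuad (gram x σ (run π w t)) (x (π (run π w t) k)) with hq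
  have hq0 : ∀ t k, 0 ≤ q t k := fun t k => invQuad_nonneg (posDef_gram x σ _) _
  have h1 : ∑ t ∈ Finset.range n, ∑ k ∈ O t, q t k ≤
      K / Real.log (1 + 1 / σ ^ 2) * Real.log (gram x σ (run π w n)).det := by
    calc _ ≤ ∑ t ∈ Finset.range n, K / Real.log (1 + 1 / σ ^ 2) *
          (Real.log (gram x σ (run π w (t + 1))).det - Real.log (gram x σ (run π w t)).det) :=
          Finset.sum_le_sum fun t _ => sum_invQuad_le σ hσ hx _ _ _
      _ = _ := by
          rw [← Finset.mul_sum, Finset.sum_range_sub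
            (fun t => Real.log (gram x σ (run π w t)).det)]
          simp [run, gram]
  have h2 := log_det_gram_le σ hd hx (length_run π w n).le
  have hK : 0 ≤ K / Real.log (1 + 1 / σ ^ 2) := by positivity
  have h3 := h1.trans (mul_le_mul_of_nonneg_left h2 hK)
  rw [Finset.sum_sigma'] at h3 ⊢
  set I := (Finset.range n).sigma O
  have hcard : (I.card : ℝ) ≤ n * K := by
    rw [Finset.card_sigma]
    have := Finset.sum_le_card_nsmul (Finset.range n) (fun t => (O t).card) K
      fun t _ => card_observed_le _
    rw [Finset.card_range, smul_eq_mul] at this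
    exact_mod_cast this
  have hcs := sq_sum_le_card_mul_sum_sq (s := I) (f := fun i => √(q i.1 i.2))
  simp only [Real.sq_sqrt (hq0 _ _)] at hcs
  have hK0 : (0 : ℝ) ≤ K := by positivity
  set ℓ := Real.log (1 + n * K / (d * σ ^ 2))
  rw [← Real.sqrt_sq hK0, ← Real.sqrt_mul (by positivity)]
  refine Real.le_sqrt_of_sq_le (hcs.trans ?_)
  have hsum0 : 0 ≤ ∑ i ∈ I, q i.1 i.2 := Finset.sum_nonneg fun i _ => hq0 _ _
  calc _ ≤ (n * K : ℝ) * (K / Real.log (1 + 1 / σ ^ 2) *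
        (d * ℓ)) := by gcongr
    _ = _ := by ring

end Gram

/-! ### The confidence ellipsoid -/

namespace LinearBandit

variable {d L K : ℕ} (B : LinearBandit d L K) (σ : ℝ)

/-- The noise in the observations of the history, normalized by `σ`: the sum of
`(w_t(e) - wbar(e)) σ⁻¹ x_e` over all observations, expressed through the statistics that
CascadeLinUCB keeps. -/
def noise (h : History L K) : Fin d → ℝ :=
  σ⁻¹ • (response B.x h - (σ ^ 2) • ((gram B.x σ h - 1) *ᵥ ⇑B.θ))

variable {σ}

lemma noise_cons (hσ : 0 < σ) (A : RecList L K) (v : Fin L → Bool) (h : History L K) :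
    B.noise σ ((A, click A v) :: h) = B.noise σ h + ∑ k ∈ observed (click A v),
      (toReal v (A k) - B.wbar (A k) : ℝ) • (σ⁻¹ • ⇑(B.x (A k))) := by
  have h1 : (gram B.x σ ((A, click A v) :: h) - 1) *ᵥ ⇑B.θ =
      (gram B.x σ h - 1) *ᵥ ⇑B.θ + ∑ k ∈ observed (click A v),
        ((σ ^ 2)⁻¹ * B.wbar (A k) : ℝ) • ⇑(B.x (A k)) := by
    rw [gram, add_sub_right_comm, add_mulVec, sum_mulVec]
    congr 1
    refine Finset.sum_congr rfl fun k _ => ?_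
    rw [smul_mulVec, vecMulVec_mulVec, B.linear]
    ext i
    simp
    ring
  have h2 : response B.x ((A, click A v) :: h) = response B.x h +
      ∑ k ∈ observed (click A v), toReal v (A k) • ⇑(B.x (A k)) := by
    rw [response]
    congr 1
    exact Finset.sum_congr rfl fun k hk => by rw [ite_click_eq hk]
  rw [noise, noise, h1, h2, smul_add, Finset.smul_sum, add_sub_add_comm,
    ← Finset.sum_sub_distrib, smul_add, Finset.smul_sum]
  congr 1
  refine Finset.sum_congr rfl fun k _ => ?_
  ext i
  simp
  field_simp

lemma integral_potential_cons_le (hσ : 0 < σ) (A : RecList L K) (h : History L K) :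
    ∫ v, potential (gram B.x σ ((A, click A v) :: h)) (B.noise σ ((A, click A v) :: h)) ∂B.law ≤
      potential (gram B.x σ h) (B.noise σ h) := by
  have := B.integral_potential_scanned_le (posDef_gram B.x σ h) (B.noise σ h) A
    (fun k => σ⁻¹ • ⇑(B.x (A k))) le_rfl
  simpa only [gram_cons, B.noise_cons hσ, observed_click] using this

section

variable {B} {Ω : Type*} [MeasurableSpace Ω] {μ : Measure Ω}
  [IsProbabilityMeasure μ] {w : ℕ → Ω → Fin L → Bool}

/-- The potential is a supermartingale along the run, started at `1`. -/
lemma integral_potential_run_le (hσ : 0 < σ) (hw : B.IsWeightSequence μ w) (π : Policy L K)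
    (t : ℕ) :
    ∫ ω, potential (gram B.x σ (run π (fun s => w s ω) t))
      (B.noise σ (run π (fun s => w s ω) t)) ∂μ ≤ 1 := by
  induction t with
  | zero => simp [run, potential, noise, gram, response, invQuad]
  | succ t ih =>
    refine le_trans ?_ ih
    have h1 := integral_run_weight hw π t fun h v =>
      potential (gram B.x σ ((π h, click (π h) v) :: h))
        (B.noise σ ((π h, click (π h) v) :: h))
    simp only [run]
    rw [h1]
    exact integral_mono (integrable_run hw π t fun h => ∫ v, potential
        (gram B.x σ ((π h, click (π h) v) :: h)) (B.noise σ ((π h, click (π h) v) :: h)) ∂B.law)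
      (integrable_run hw π t fun h => potential (gram B.x σ h) (B.noise σ h))
      fun ω => B.integral_potential_cons_le hσ _ _

end

/-- A small potential confines the error of the estimate to the confidence ellipsoid. -/
lemma abs_dotProduct_thetaBar_sub_le (hd : 0 < d) (hσ : 0 < σ) {n : ℕ} {c : ℝ}
    (hc : width d K n σ + ‖B.θ‖ ≤ c) {h : History L K} (hn : h.length ≤ n)
    (hp : potential (gram B.x σ h) (B.noise σ h) ≤ n * K) (e : Fin L) :
    |⇑(B.x e) ⬝ᵥ thetaBar B.x σ h - B.wbar e| ≤ c * √(invQuad (gram B.x σ h) (B.x e)) := by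
  set M := gram B.x σ h with hM
  have hpd : M.PosDef := posDef_gram B.x σ h
  have h1 : thetaBar B.x σ h - ⇑B.θ = M⁻¹ *ᵥ (σ⁻¹ • B.noise σ h + (-1 : ℝ) • ⇑B.θ) := by
    have h2 : σ⁻¹ • B.noise σ h + (-1 : ℝ) • ⇑B.θ =
        (σ ^ 2)⁻¹ • response B.x h - M *ᵥ ⇑B.θ := by
      rw [noise, ← hM, sub_mulVec, one_mulVec]
      ext i
      simp
      field_simp
      ring
    rw [h2, mulVec_sub, inv_mulVec_mulVec hpd, mulVec_smul]
    rfl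
  have h3 : √(invQuad M (B.noise σ h)) ≤
      √(d * Real.log (1 + n * K / (d * σ ^ 2)) + 2 * Real.log (n * K)) := by
    apply Real.sqrt_le_sqrt
    have hs : 0 < √M.det := Real.sqrt_pos.2 hpd.det_pos
    have h4 := Real.log_le_log (by unfold potential; positivity) hp
    rw [potential, Real.log_mul (by positivity) (by positivity), Real.log_exp, Real.log_inv,
      Real.log_sqrt hpd.det_pos.le] at h4
    have h5 := log_det_gram_le σ hd B.norm_x_le hn
    linarith
  have h6 : √(invQuad M ((-1 : ℝ) • ⇑B.θ)) ≤ ‖B.θ‖ := by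
    rw [invQuad_smul]
    refine Real.sqrt_le_iff.2 ⟨norm_nonneg _, ?_⟩
    have := invQuad_gram_le B.x σ h B.θ
    rw [dotProduct_self_eq_norm_sq] at this
    linarith
  have h7 : √(invQuad M (σ⁻¹ • B.noise σ h)) = σ⁻¹ * √(invQuad M (B.noise σ h)) := by
    rw [invQuad_smul, Real.sqrt_mul (by positivity), Real.sqrt_sq (by positivity)]
  rw [B.linear, ← dotProduct_sub, h1]
  refine (abs_dotProduct_inv_mulVec_le hpd _ _).trans ?_
  rw [mul_comm c]
  refine mul_le_mul_of_nonneg_left ?_ (Real.sqrt_nonneg _)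
  refine (sqrt_invQuad_add_le hpd _ _).trans (le_trans ?_ hc)
  rw [h7, width]
  gcongr

end LinearBandit

/-! ### Rewards and greedy lists -/

section Greedy

variable {d L K : ℕ}

lemma reward_mem_Icc (A : RecList L K) {w : Fin L → ℝ} (hw : ∀ e, w e ∈ Set.Icc (0 : ℝ) 1) :
    reward A w ∈ Set.Icc (0 : ℝ) 1 := by
  have h0 : 0 ≤ ∏ k, (1 - w (A k)) := Finset.prod_nonneg fun k _ => by linarith [(hw (A k)).2]
  have h1 : ∏ k, (1 - w (A k)) ≤ 1 :=
    Finset.prod_le_one (fun k _ => by linarith [(hw (A k)).2])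
      fun k _ => by linarith [(hw (A k)).1]
  unfold reward
  constructor <;> linarith

lemma reward_mono (A : RecList L K) {w w' : Fin L → ℝ} (h : ∀ e, w e ≤ w' e)
    (h1 : ∀ e, w' e ≤ 1) : reward A w ≤ reward A w' := by
  unfold reward
  have := Finset.prod_le_prod (s := Finset.univ) (f := fun k => 1 - w' (A k))
    (g := fun k => 1 - w (A k)) (fun k _ => by linarith [h1 (A k)])
    fun k _ => by linarith [h (A k)]
  linarith

/-- A list whose items all have weights at least those of the items outside of it maximizes the
reward. -/
lemma reward_le_of_top (A A' : RecList L K) {u : Fin L → ℝ} (hu : ∀ e, u e ≤ 1)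
    (htop : ∀ k e, (∀ j, A j ≠ e) → u e ≤ u (A k)) : reward A' u ≤ reward A u := by
  classical
  set s := Finset.univ.map A
  set s' := Finset.univ.map A'
  have hprod : ∀ A : RecList L K, ∏ k, (1 - u (A k)) = ∏ e ∈ Finset.univ.map A, (1 - u e) :=
    fun A => (Finset.prod_map _ A fun e => 1 - u e).symm
  unfold reward
  rw [hprod A, hprod A', sub_le_sub_iff_left]
  change ∏ e ∈ s, (1 - u e) ≤ ∏ e ∈ s', (1 - u e)
  have hcard : (s \ s').card = (s' \ s).card :=
    Finset.card_sdiff_comm (by simp [s, s'])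
  rw [← Finset.prod_inter_mul_prod_sdiff s s', ← Finset.prod_inter_mul_prod_sdiff s' s,
    Finset.inter_comm s' s]
  refine mul_le_mul_of_nonneg_left ?_ (Finset.prod_nonneg fun e _ => by linarith [hu e])
  have hle : ∀ e ∈ s \ s', ∀ e' ∈ s' \ s, 1 - u e ≤ 1 - u e' := by
    intro e he e' he'
    obtain ⟨k, -, rfl⟩ := Finset.mem_map.1 (Finset.mem_sdiff.1 he).1
    have := htop k e' fun j hj => (Finset.mem_sdiff.1 he').2 (by simp [s, ← hj])
    linarith
  rcases (s \ s').eq_empty_or_nonempty with h | h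
  · have h' : s' \ s = ∅ := by rw [← Finset.card_eq_zero, ← hcard, h, Finset.card_empty]
    rw [h, h']
  · obtain ⟨e₀, he₀, hmax⟩ := Finset.exists_max_image (s \ s') (fun e => 1 - u e) h
    calc ∏ e ∈ s \ s', (1 - u e) ≤ ∏ e ∈ s \ s', (1 - u e₀) :=
          Finset.prod_le_prod (fun e _ => by linarith [hu e]) hmax
      _ = ∏ e ∈ s' \ s, (1 - u e₀) := by rw [Finset.prod_const, Finset.prod_const, hcard]
      _ ≤ _ := Finset.prod_le_prod (fun e _ => by linarith [hu e₀]) fun e he => hle _ he₀ _ he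

/-- The loss decomposes along the list: with `a = 1 - wbar`, the factor `∏_{j < k} a j` is the
probability that position `k` is scanned. -/
lemma prod_sub_prod_le {n : ℕ} (a b : Fin n → ℝ) (hb : ∀ k, 0 ≤ b k) (hba : ∀ k, b k ≤ a k)
    (ha : ∀ k, a k ≤ 1) :
    ∏ k, a k - ∏ k, b k ≤ ∑ k, (∏ j ∈ Finset.Iio k, a j) * (a k - b k) := by
  induction n with
  | zero => simp
  | succ n ih =>
    have h := ih (fun k => a k.castSucc) (fun k => b k.castSucc) (fun k => hb _)
      (fun k => hba _) fun k => ha _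
    rw [Fin.prod_univ_castSucc, Fin.prod_univ_castSucc, Fin.sum_univ_castSucc]
    have e1 : ∀ k : Fin n, ∏ j ∈ Finset.Iio k.castSucc, a j =
        ∏ j ∈ Finset.Iio k, a j.castSucc := by
      intro k
      rw [← Fin.map_castSuccEmb_Iio, Finset.prod_map]
      rfl
    have e2 : ∏ j ∈ Finset.Iio (Fin.last n), a j = ∏ j : Fin n, a j.castSucc := by
      rw [Fin.Iio_last_eq_map, Finset.prod_map]
      rfl
    simp only [e1, e2]
    have hb0 : 0 ≤ ∏ k : Fin n, b k.castSucc := Finset.prod_nonneg fun k _ => hb _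
    have hba0 : ∏ k : Fin n, b k.castSucc ≤ ∏ k : Fin n, a k.castSucc :=
      Finset.prod_le_prod (fun k _ => hb _) fun k _ => hba _
    have := hb (Fin.last n)
    have := (hba (Fin.last n)).trans (ha _)
    nlinarith

end Greedy

/-! ### The regret bound -/

namespace LinearBandit

variable {d L K : ℕ} (B : LinearBandit d L K) {σ : ℝ}

/-- Optimism: on the confidence event, the loss of a step is at most the expected sum of the
confidence widths of the scanned items. -/
lemma reward_sub_le {c : ℝ} {h : History L K}
    (hgood : ∀ e, |⇑(B.x e) ⬝ᵥ thetaBar B.x σ h - B.wbar e| ≤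
      c * √(invQuad (gram B.x σ h) (B.x e)))
    {π : Policy L K} (hπ : IsCascadeLinUCB B.x σ c π) (A : RecList L K) :
    reward A (fun e => (B.wbar e : ℝ)) - reward (π h) (fun e => (B.wbar e : ℝ)) ≤
      2 * c * ∫ v, ∑ k ∈ observed (click (π h) v),
        √(invQuad (gram B.x σ h) (B.x (π h k))) ∂B.law := by
  set u := ucb B.x σ c h with hu
  have hu1 : ∀ e, u e ≤ 1 := fun e => min_le_right _ _
  have hlow : ∀ e, (B.wbar e : ℝ) ≤ u e := fun e =>
    le_min (by have := (abs_le.1 (hgood e)).1; simp only [invQuad] at this; linarith)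
      (B.wbar e).2.2
  have hupp : ∀ e, u e - B.wbar e ≤ 2 * c * √(invQuad (gram B.x σ h) (B.x e)) := fun e => by
    have h1 := (abs_le.1 (hgood e)).2
    have h2 : u e ≤ _ := min_le_left _ _
    simp only [invQuad] at h1 ⊢
    linarith
  have htop : reward A u ≤ reward (π h) u :=
    reward_le_of_top _ _ hu1 fun k e he => hπ h k e fun j _ => he j
  have hmono := reward_mono A hlow hu1
  have hdec := prod_sub_prod_le (fun k => 1 - (B.wbar (π h k) : ℝ)) (fun k => 1 - u (π h k))
    (fun k => by linarith [hu1 (π h k)]) (fun k => by linarith [hlow (π h k)])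
    (fun k => by linarith [(B.wbar (π h k)).2.1])
  rw [B.integral_sum_observed, Finset.mul_sum]
  calc _ ≤ reward (π h) u - reward (π h) (fun e => (B.wbar e : ℝ)) := by linarith
    _ ≤ _ := by unfold reward; linarith
    _ ≤ _ := by
      refine Finset.sum_le_sum fun k _ => ?_
      have h0 : 0 ≤ ∏ j ∈ Finset.Iio k, (1 - (B.wbar (π h j) : ℝ)) :=
        Finset.prod_nonneg fun j _ => by linarith [(B.wbar (π h j)).2.2]
      have := mul_le_mul_of_nonneg_left (hupp (π h k)) h0
      refine le_trans (le_of_eq ?_) (this.trans (le_of_eq ?_)) <;> ring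

variable {B} {Ω : Type*} [MeasurableSpace Ω] {μ : Measure Ω}
  [IsProbabilityMeasure μ] {w : ℕ → Ω → Fin L → Bool}

/-- The per-step loss against `A` is in expectation the loss for the mean weights. -/
lemma expectedRegret_eq (hw : B.IsWeightSequence μ w) (A : RecList L K) (π : Policy L K)
    (n : ℕ) :
    expectedRegret μ w A π n = ∑ t ∈ Finset.range n,
      ∫ ω, (reward A (fun e => (B.wbar e : ℝ)) -
        reward (π (run π (fun s => w s ω) t)) (fun e => (B.wbar e : ℝ))) ∂μ := by
  unfold expectedRegret
  rw [integral_finsetSum _ fun t _ => integrable_run_weight hw π t fun h v =>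
    reward A (toReal v) - reward (π h) (toReal v)]
  refine Finset.sum_congr rfl fun t _ => ?_
  rw [integral_run_weight hw π t fun h v => reward A (toReal v) - reward (π h) (toReal v)]
  refine integral_congr_ae (Filter.Eventually.of_forall fun ω => ?_)
  simp only
  rw [integral_sub Integrable.of_finite Integrable.of_finite, B.integral_reward,
    B.integral_reward]

/-- Outside of an event of probability at most `1 / (nK)` the potential is below `nK`, and there
the loss is bounded by the confidence widths; on the event itself it is at most `1`. -/
lemma step_regret_le (hd : 0 < d) (hσ : 0 < σ) {n : ℕ} (hnK : 0 < (n * K : ℝ)) {c : ℝ}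
    (hc0 : 0 ≤ c) (hc : width d K n σ + ‖B.θ‖ ≤ c) (hw : B.IsWeightSequence μ w)
    {π : Policy L K} (hπ : IsCascadeLinUCB B.x σ c π) (A : RecList L K) {t : ℕ} (ht : t ≤ n) :
    ∫ ω, (reward A (fun e => (B.wbar e : ℝ)) -
        reward (π (run π (fun s => w s ω) t)) (fun e => (B.wbar e : ℝ))) ∂μ ≤
      1 / (n * K) + 2 * c * ∫ ω, ∑ k ∈ observed (click (π (run π (fun s => w s ω) t)) (w t ω)),
        √(invQuad (gram B.x σ (run π (fun s => w s ω) t))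
          (B.x (π (run π (fun s => w s ω) t) k))) ∂μ := by
  set P : History L K → ℝ := fun h => potential (gram B.x σ h) (B.noise σ h) with hP
  set W : History L K → ℝ := fun h => ∫ v, ∑ k ∈ observed (click (π h) v),
        √(invQuad (gram B.x σ h) (B.x (π h k))) ∂B.law with hW
  have hint := integrable_run hw π t
  rw [integral_run_weight hw π t fun h v => ∑ k ∈ observed (click (π h) v),
        √(invQuad (gram B.x σ h) (B.x (π h k)))]
  -- pointwise Markov inequality: `P / (nK)` dominates the indicator of the bad event
  have hpt : ∀ h : History L K, h.length ≤ n →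
      reward A (fun e => (B.wbar e : ℝ)) - reward (π h) (fun e => (B.wbar e : ℝ)) ≤
        P h / (n * K) + 2 * c * W h := by
    intro h hn
    have hP0 : 0 ≤ P h := potential_nonneg _ _
    have hW0 : 0 ≤ W h := integral_nonneg fun v => Finset.sum_nonneg fun k _ => Real.sqrt_nonneg _
    rcases le_total (P h) (n * K) with hp | hp
    · have := B.reward_sub_le (B.abs_dotProduct_thetaBar_sub_le hd hσ hc hn hp) hπ A
      have : 0 ≤ P h / (n * K) := by positivity
      linarith
    · have h1 : 1 ≤ P h / (n * K) := (one_le_div hnK).2 hp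
      have h2 := (reward_mem_Icc A fun e => (B.wbar e).2).2
      have h3 := (reward_mem_Icc (π h) fun e => (B.wbar e).2).1
      have : 0 ≤ 2 * c * W h := by positivity
      linarith
  calc _ ≤ ∫ ω, (P (run π (fun s => w s ω) t) / (n * K) +
          2 * c * W (run π (fun s => w s ω) t)) ∂μ :=
        integral_mono (hint fun h => reward A (fun e => (B.wbar e : ℝ)) -
          reward (π h) (fun e => (B.wbar e : ℝ))) (hint fun h => P h / (n * K) + 2 * c * W h)
          fun ω => hpt _ (by rw [length_run]; exact ht)
    _ = (∫ ω, P (run π (fun s => w s ω) t) ∂μ) / (n * K) +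
          2 * c * ∫ ω, W (run π (fun s => w s ω) t) ∂μ := by
        rw [integral_add (hint fun h => P h / (n * K)) (hint fun h => 2 * c * W h),
          integral_div, integral_const_mul]
    _ ≤ _ := by
        gcongr
        exact integral_potential_run_le hσ hw π t

theorem expectedRegret_le (hd : 0 < d) (hK : 0 < K) {n : ℕ} (hn : 0 < n) (hσ : 0 < σ) {c : ℝ}
    (hc : width d K n σ + ‖B.θ‖ ≤ c) (hw : B.IsWeightSequence μ w)
    {π : Policy L K} (hπ : IsCascadeLinUCB B.x σ c π) (A : RecList L K) :
    expectedRegret μ w A π n ≤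
      2 * c * K * √(d * n * Real.log (1 + n * K / (d * σ ^ 2)) / Real.log (1 + 1 / σ ^ 2)) + 1 := by
  have hc0 : 0 ≤ c := le_trans (by unfold width; positivity) hc
  have hK1 : (1 : ℝ) ≤ K := by exact_mod_cast hK
  have hn0 : (0 : ℝ) < n := by exact_mod_cast hn
  have hnK : 0 < (n * K : ℝ) := by positivity
  rw [expectedRegret_eq hw]
  set S : ℕ → Ω → ℝ := fun t ω =>
    ∑ k ∈ observed (click (π (run π (fun s => w s ω) t)) (w t ω)),
      √(invQuad (gram B.x σ (run π (fun s => w s ω) t))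
        (B.x (π (run π (fun s => w s ω) t) k))) with hS
  have hSi : ∀ t, Integrable (S t) μ := fun t =>
    integrable_run_weight hw π t fun h v => ∑ k ∈ observed (click (π h) v),
      √(invQuad (gram B.x σ h) (B.x (π h k)))
  set R := √(d * n * Real.log (1 + n * K / (d * σ ^ 2)) / Real.log (1 + 1 / σ ^ 2)) with hR
  have hsum : ∑ t ∈ Finset.range n, ∫ ω, S t ω ∂μ ≤ K * R := by
    rw [← integral_finsetSum _ fun t _ => hSi t]
    refine (integral_mono (integrable_finsetSum _ fun t _ => hSi t) (integrable_const (K * R))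
      fun ω => sum_sqrt_invQuad_le σ hd hσ B.norm_x_le π (fun s => w s ω) n).trans ?_
    simp
  calc _ ≤ ∑ t ∈ Finset.range n, (1 / (n * K) + 2 * c * ∫ ω, S t ω ∂μ) :=
        Finset.sum_le_sum fun t ht => step_regret_le hd hσ hnK hc0 hc hw hπ A
          (Finset.mem_range.1 ht).le
    _ = 1 / K + 2 * c * ∑ t ∈ Finset.range n, ∫ ω, S t ω ∂μ := by
        rw [Finset.sum_add_distrib, ← Finset.mul_sum, Finset.sum_const, Finset.card_range,
          nsmul_eq_mul]
        field_simp
    _ ≤ 1 + 2 * c * (K * R) := by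
        gcongr
        exact (div_le_one (by positivity)).2 hK1
    _ = _ := by ring

end LinearBandit

/-! ### Order of growth -/

lemma log_one_add_div_le {N s : ℝ} (hN : 1 ≤ N) (hs : 0 < s) :
    Real.log (1 + N / s) ≤ (Real.log (1 + 1 / s) / Real.log 2 + 1) * Real.log (1 + N) := by
  have h2 : 0 < Real.log 2 := Real.log_pos one_lt_two
  have hl : 0 ≤ Real.log (1 + 1 / s) := Real.log_nonneg (by simp; positivity)
  have h1 : Real.log 2 ≤ Real.log (1 + N) := Real.log_le_log two_pos (by linarith)
  have h3 : Real.log (1 + N / s) ≤ Real.log ((1 + 1 / s) * (1 + N)) := by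
    apply Real.log_le_log (by positivity)
    have : 0 < 1 / s := by positivity
    have : N / s = 1 / s * N := by ring
    nlinarith
  rw [Real.log_mul (by positivity) (by positivity)] at h3
  have h4 : Real.log (1 + 1 / s) ≤ Real.log (1 + 1 / s) / Real.log 2 * Real.log (1 + N) := by
    rw [div_mul_eq_mul_div, le_div_iff₀ h2]
    gcongr
  linarith

/-- With the confidence parameter `width + η`, the regret bound is of order `K d √n log (1 + nK)`. -/
lemma exists_regret_bound_le {σ η : ℝ} (hσ : 0 < σ) (hη : 0 ≤ η) :
    ∃ C : ℝ, ∀ d K n : ℕ, 0 < d → 0 < K → 0 < n →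
      2 * (width d K n σ + η) * K *
          √(d * n * Real.log (1 + n * K / (d * σ ^ 2)) / Real.log (1 + 1 / σ ^ 2)) + 1 ≤
        C * K * d * √n * Real.log (1 + n * K) := by
  have h2 : 0 < Real.log 2 := Real.log_pos one_lt_two
  have h21 : Real.log 2 ≤ 1 := by linarith [Real.log_le_sub_one_of_pos two_pos]
  set l := Real.log (1 + 1 / σ ^ 2) with hl_def
  have hl : 0 < l := Real.log_pos (by simp; positivity)
  set a := l / Real.log 2 + 1 with ha_def
  have ha : 0 < a := by positivity
  refine ⟨2 * (σ⁻¹ * √(a + 2) + η / Real.log 2) * √(a / l) + 1 / Real.log 2, ?_⟩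
  intro d K n hd hK hn
  have hd1 : (1 : ℝ) ≤ d := by exact_mod_cast hd
  have hK1 : (1 : ℝ) ≤ K := by exact_mod_cast hK
  have hn1 : (1 : ℝ) ≤ n := by exact_mod_cast hn
  have hN : 1 ≤ (n * K : ℝ) := one_le_mul_of_one_le_of_one_le hn1 hK1
  set Λ := Real.log (1 + n * K) with hΛ_def
  have hΛ2 : Real.log 2 ≤ Λ := Real.log_le_log two_pos (by linarith)
  have hΛ : 0 < Λ := h2.trans_le hΛ2
  have hlog : Real.log (n * K) ≤ Λ := Real.log_le_log (by positivity) (by linarith)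
  have hℓ : Real.log (1 + n * K / (d * σ ^ 2)) ≤ a * Λ := by
    refine le_trans ?_ (log_one_add_div_le hN (by positivity : 0 < σ ^ 2))
    apply Real.log_le_log (by positivity)
    have : σ ^ 2 ≤ d * σ ^ 2 := le_mul_of_one_le_left (by positivity) hd1
    gcongr
  set y := √(d * Λ) with hy
  have hysq : y ^ 2 = d * Λ := Real.sq_sqrt (by positivity)
  have hwidth : width d K n σ ≤ σ⁻¹ * √(a + 2) * y := by
    rw [width, mul_assoc, hy, ← Real.sqrt_mul (by positivity)]
    gcongr
    calc _ ≤ d * (a * Λ) + 2 * (d * Λ) := by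
          gcongr
          exact hlog.trans (le_mul_of_one_le_left hΛ.le hd1)
      _ = _ := by ring
  have hroot : √(d * n * Real.log (1 + n * K / (d * σ ^ 2)) / l) ≤ √(a / l) * √n * y := by
    rw [hy, ← Real.sqrt_mul (by positivity), ← Real.sqrt_mul (by positivity)]
    apply Real.sqrt_le_sqrt
    calc _ ≤ d * n * (a * Λ) / l := by gcongr
      _ = _ := by ring
  have hy1 : Real.log 2 ≤ y := by
    apply Real.le_sqrt_of_sq_le
    nlinarith
  have hηy : η ≤ η / Real.log 2 * y := by
    rw [div_mul_eq_mul_div, le_div_iff₀ h2]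
    gcongr
  have hsn : 1 ≤ √(n : ℝ) := Real.one_le_sqrt.2 hn1
  have hone : 1 ≤ 1 / Real.log 2 * (K * d * √n * Λ) := by
    rw [div_mul_eq_mul_div, one_mul, one_le_div h2]
    refine hΛ2.trans (le_mul_of_one_le_left hΛ.le ?_)
    exact one_le_mul_of_one_le_of_one_le (one_le_mul_of_one_le_of_one_le hK1 hd1) hsn
  have hw0 : 0 ≤ width d K n σ := by unfold width; positivity
  calc _ ≤ 2 * (σ⁻¹ * √(a + 2) * y + η / Real.log 2 * y) * K * (√(a / l) * √n * y) +
        1 / Real.log 2 * (K * d * √n * Λ) := by gcongr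
    _ = 2 * (σ⁻¹ * √(a + 2) + η / Real.log 2) * √(a / l) * K * √n * y ^ 2 +
        1 / Real.log 2 * (K * d * √n * Λ) := by ring
    _ = _ := by rw [hysq]; ring

end CascadeBandit

end

open CascadeBandit in
theorem theorem1 :
    -- the regret bound
    (∀ (d L K n : ℕ), 0 < d → 0 < K → 0 < n →
      ∀ (B : LinearBandit d L K) (σ c : ℝ), 0 < σ → width d K n σ + ‖B.θ‖ ≤ c →
      ∀ (Ω : Type*) [MeasurableSpace Ω] (μ : Measure Ω) [IsProbabilityMeasure μ]
        (w : ℕ → Ω → Fin L → Bool), B.IsWeightSequence μ w →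
      ∀ Astar : RecList L K, B.IsOptimal Astar →
      ∀ π : Policy L K, IsCascadeLinUCB B.x σ c π →
        expectedRegret μ w Astar π n ≤
          2 * c * K * √(d * n * Real.log (1 + n * K / (d * σ ^ 2)) / Real.log (1 + 1 / σ ^ 2)) + 1) ∧
    -- its order of growth, uniformly in the number of items
    (∀ σ η : ℝ, 0 < σ → ∃ C : ℝ, ∀ (d L K n : ℕ), 0 < d → 0 < K → 0 < n →
      ∀ B : LinearBandit d L K, ‖B.θ‖ ≤ η →
      ∀ (Ω : Type*) [MeasurableSpace Ω] (μ : Measure Ω) [IsProbabilityMeasure μ]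
        (w : ℕ → Ω → Fin L → Bool), B.IsWeightSequence μ w →
      ∀ Astar : RecList L K, B.IsOptimal Astar →
      ∀ π : Policy L K, IsCascadeLinUCB B.x σ (width d K n σ + η) π →
        expectedRegret μ w Astar π n ≤ C * K * d * √n * Real.log (1 + n * K)) := by
  refine ⟨?_, fun σ η hσ => ?_⟩
  · intro d L K n hd hK hn B σ c hσ hc Ω _ μ _ w hw Astar _ π hπ
    exact LinearBandit.expectedRegret_le hd hK hn hσ hc hw hπ Astar
  · -- for negative `η` no instance satisfies the norm bound, and any constant will do
    rcases lt_or_ge η 0 with hη | hη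
    · exact ⟨0, fun d L K n _ _ _ B hB => absurd ((norm_nonneg B.θ).trans hB) hη.not_ge⟩
    · obtain ⟨C, hC⟩ := exists_regret_bound_le hσ hη
      refine ⟨C, ?_⟩
      intro d L K n hd hK hn B hB Ω _ μ _ w hw Astar _ π hπ
      exact (LinearBandit.expectedRegret_le hd hK hn hσ (by linarith) hw hπ Astar).trans
        (hC d K n hd hK hn)
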